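/- Let $\mathbb D=\{z\in\mathbb C:|z|<1\}$. For functions $f,g$ analytic in $\mathbb D$, write $f\prec g$ ($f$ is subordinate to $g$) if there is an analytic function $w$ in $\mathbb D$ with $w(0)=0$ and $|w(z)|\le|z|$ such that $f(z)=g(w(z))$ for all $z\in\mathbb D$. **Theorem.** Let $\alpha_1,\alpha_2,\alpha_3>0$, let $m,k$ be real numbers with $k\ge m\ge 2$, and put $$L=\alpha_1-\alpha_2-m^2\alpha_3-3m(k-1)\alpha_3 .$$ Let $p$ be analytic in $\mathbb D$ with $p(0)=1$, and put $$P(z)=1+\alpha_1zp'(z)+\alpha_2z^2p''(z)+\alpha_3z^3p'''(z).$$ Then $p(z)\prec e^z$ in each of the following cases: 1. $L\ge e(e-1)$ and $P(z)\prec e^z$; 2. $L\ge\sqrt2\,e$ and $P(z)\prec z+\sqrt{1+z^2}$ (crescent); 3. $L\ge e\sinh 1$ and $P(z)\prec 1+\sin z$ (sine); 4. $L\ge e^2$ and $P(z)\prec 1+ze^z$ (cardioid); 5. $2L\ge\pi e$ and $P(z)\prec 1+\sinh^{-1}z$. Here $\sqrt{\cdot}$ and $\sinh^{-1}z=\log\bigl(z+\sqrt{1+z^2}\bigr)$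 denote principal branches. -/

import Mathlib

/-- A Schwarz function: analytic in the unit disk `|z| < 1`, with `w 0 = 0` and `|w z| ≤ |z|`. -/
def IsSchwarzFunction (w : ℂ → ℂ) : Prop :=
  DifferentiableOn ℂ w (Metric.ball 0 1) ∧ w 0 = 0 ∧ ∀ z ∈ Metric.ball (0 : ℂ) 1, ‖w z‖ ≤ ‖z‖

/-- Subordination `f ≺ g` of functions on the unit disk: `f = g ∘ w` there, for some Schwarz
function `w`. -/
def IsSubordinate (f g : ℂ → ℂ) : Prop :=
  ∃ w : ℂ → ℂ, IsSchwarzFunction w ∧ ∀ z ∈ Metric.ball (0 : ℂ) 1, f z = g (w z)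

/-- The expression `1 + α₁ z p'(z) + α₂ z² p''(z) + α₃ z³ p'''(z)`. -/
noncomputable def thirdOrderExpr (α₁ α₂ α₃ : ℝ) (p : ℂ → ℂ) (z : ℂ) : ℂ :=
  1 + α₁ * z * deriv p z + α₂ * z ^ 2 * iteratedDeriv 2 p z + α₃ * z ^ 3 * iteratedDeriv 3 p z

/-- The principal branch of `sinh⁻¹`; it is analytic in the unit disk. -/
noncomputable def complexArsinh (z : ℂ) : ℂ := Complex.log (z + Complex.sqrt (1 + z ^ 2))

/-! Write `p - 1 = ∑ a n z ^ n` over `n ≥ 1`. The coefficients of `P - 1` are `l n * a n` with `l n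
≥ α₁ n`, since the second and third order terms contribute nonnegatively. If `|P - 1| ≤ M`, Bessel
bounds the sum of squares of `n |a n| r ^ n` by `(M / α₁) ^ 2`, and Cauchy–Schwarz against `∑ 1 / n
^ 2 = π ^ 2 / 6` gives `|p - 1| ≤ π M / (√6 α₁)` (`sq_norm_sub_one_le`). Each lower bound on `L ≤
α₁` forces `5 M ^ 2 ≤ α₁ ^ 2`: in the first four cases it is `e M`, and `e ^ 2 > 5`; the fifth has a
similar margin. So `p` stays so close to `1` that `|log p| ≤ 1`, and by the Schwarz lemma `log p` is
the required Schwarz function. -/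

/-- Bessel's inequality for the coefficients of a power series bounded by `M` on a circle. -/
theorem sum_sq_coeff_le_of_norm_le {c : ℕ → ℂ} {f : ℂ → ℂ} {r M : ℝ} (hr : 0 ≤ r)
    (hs : Summable fun n => ‖c n‖ * r ^ n)
    (hf : ∀ z : ℂ, ‖z‖ = r → HasSum (fun n => c n * z ^ n) (f z))
    (hM : ∀ z : ℂ, ‖z‖ = r → ‖f z‖ ≤ M) (s : Finset ℕ) :
    ∑ n ∈ s, (‖c n‖ * r ^ n) ^ 2 ≤ M ^ 2 := by
  have : Fact (0 < (1 : ℝ)) := ⟨one_pos⟩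
  let φ : ℕ → C(AddCircle (1 : ℝ), ℂ) := fun n => (c n * (r : ℂ) ^ n) • fourier (n : ℤ)
  have hφn : ∀ n, ‖φ n‖ = ‖c n‖ * r ^ n := fun n => by
    simp [φ, norm_smul, fourier_norm, abs_of_nonneg hr]
  have hφ : Summable φ := Summable.of_norm (by simpa only [hφn] using hs)
  obtain ⟨F, hF⟩ := hφ
  have hM0 : 0 ≤ M := (norm_nonneg _).trans (hM r (by simp [abs_of_nonneg hr]))
  have hFM : ‖F‖ ≤ M := by
    rw [ContinuousMap.norm_le _ hM0]
    intro t
    have h1 : HasSum (fun n => φ n t) (F t) := ContinuousMap.hasSum_apply hF t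
    have hz : ‖(r : ℂ) * fourier 1 t‖ = r := by
      rw [norm_mul, Complex.norm_real, Real.norm_of_nonneg hr, fourier_one, Circle.norm_coe, mul_one]
    have h2 := hf _ hz
    have h3 : (fun n => φ n t) = fun n => c n * ((r : ℂ) * fourier 1 t) ^ n := by
      funext n
      simp only [φ, ContinuousMap.smul_apply, smul_eq_mul, mul_pow, fourier_apply, mul_assoc]
      congr 2
      simp [AddCircle.toCircle_nsmul]
    rw [h3] at h1
    rw [h1.unique h2]
    exact hM _ hz
  -- Uniform convergence on the circle passes to `L²` of a probability measure, where the monomials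
  -- are orthonormal.
  let T := ContinuousMap.toLp (E := ℂ) 2 (@AddCircle.haarAddCircle 1 _) ℂ
  have hTF : HasSum (fun n => T (φ n)) (T F) := T.hasSum hF
  have hT : ‖T F‖ ≤ M := by
    refine (T.le_opNorm F).trans ?_
    have : ‖T‖ ≤ 1 := by
      refine (ContinuousMap.toLp_norm_le _).trans ?_
      simp [MeasureTheory.measureUnivNNReal]
    calc ‖T‖ * ‖F‖ ≤ 1 * M := by gcongr
      _ = M := one_mul M
  have horth := @orthonormal_fourier 1 _
  have hinner : ∀ n : ℕ, inner ℂ (@fourierLp 1 _ 2 _ (n : ℤ)) (T F) = c n * (r : ℂ) ^ n := by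
    intro n
    have h1 := hTF.mapL (innerSL ℂ (@fourierLp 1 _ 2 _ (n : ℤ)))
    have h2 : ∀ k, innerSL ℂ (@fourierLp 1 _ 2 _ (n : ℤ)) (T (φ k))
        = if k = n then c n * (r : ℂ) ^ n else 0 := by
      intro k
      have : T (φ k) = (c k * (r : ℂ) ^ k) • @fourierLp 1 _ 2 _ (k : ℤ) := by
        simp only [φ, map_smul]; rfl
      rw [this, innerSL_apply_apply, inner_smul_right, orthonormal_iff_ite.mp horth]
      by_cases h : k = n
      · simp [h]
      · simp [h, Ne.symm h]
    simp only [h2] at h1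
    exact h1.unique (hasSum_ite_eq n _)
  have horth' : Orthonormal ℂ fun n : ℕ => @fourierLp 1 _ 2 _ (n : ℤ) :=
    horth.comp _ Nat.cast_injective
  calc ∑ n ∈ s, (‖c n‖ * r ^ n) ^ 2
      = ∑ n ∈ s, ‖inner ℂ (@fourierLp 1 _ 2 _ (n : ℤ)) (T F)‖ ^ 2 := by
        refine Finset.sum_congr rfl fun n _ => ?_
        rw [hinner]; simp [abs_of_nonneg hr]
    _ ≤ ‖T F‖ ^ 2 := horth'.sum_inner_products_le _
    _ ≤ M ^ 2 := by gcongr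

/-- The Taylor coefficients of a derivative. -/
theorem hasSum_pow_mul_iteratedDeriv {p : ℂ → ℂ} (hp : DifferentiableOn ℂ p (Metric.ball 0 1))
    (j : ℕ) {z : ℂ} (hz : z ∈ Metric.ball (0 : ℂ) 1) :
    HasSum (fun n : ℕ => (n.descFactorial j : ℂ) * (iteratedDeriv n p 0 / n.factorial) * z ^ n)
      (z ^ j * iteratedDeriv j p z) := by
  have hd : ∀ j : ℕ, DifferentiableOn ℂ (iteratedDeriv j p) (Metric.ball 0 1) := by
    intro j
    induction j with
    | zero => simpa using hp
    | succ j ih => rw [iteratedDeriv_succ]; exact ih.deriv Metric.isOpen_ball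
  have h := (Complex.hasSum_taylorSeries_on_ball (hd j) hz).mul_left (z ^ j)
  rw [← hasSum_nat_add_iff' j, Finset.sum_eq_zero, sub_zero]
  · convert! h using 1
    funext n
    have h3 : iteratedDeriv n (iteratedDeriv j p) 0 = iteratedDeriv (n + j) p 0 := by
      simp only [iteratedDeriv_eq_iterate, ← Function.iterate_add_apply]
    have h4 : ((n + j).factorial : ℂ) = n.factorial * ((n + j).descFactorial j : ℂ) := by
      rw [← Nat.factorial_mul_descFactorial (Nat.le_add_left j n)]; simp
    have h5 : ((n + j).descFactorial j : ℂ) ≠ 0 := by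
      intro h0
      rw [h0, mul_zero] at h4
      exact (Nat.factorial_ne_zero _) (by exact_mod_cast h4)
    have h6 : (n.factorial : ℂ) ≠ 0 := by exact_mod_cast Nat.factorial_ne_zero n
    rw [h3, h4]
    simp only [smul_eq_mul, sub_zero]
    field_simp
    ring
  · intro n hn
    rw [Nat.descFactorial_of_lt (Finset.mem_range.mp hn)]; simp

/-- If `P - 1` is bounded by `M` then `p - 1` is bounded by `π M / (√6 α₁)`. -/
theorem sq_norm_sub_one_le {α₁ α₂ α₃ M : ℝ} {p : ℂ → ℂ} (hα₁ : 0 < α₁) (hα₂ : 0 ≤ α₂)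
    (hα₃ : 0 ≤ α₃) (hp : DifferentiableOn ℂ p (Metric.ball 0 1)) (hp0 : p 0 = 1)
    (hM : ∀ z ∈ Metric.ball (0 : ℂ) 1, ‖thirdOrderExpr α₁ α₂ α₃ p z - 1‖ ≤ M) {z : ℂ}
    (hz : z ∈ Metric.ball (0 : ℂ) 1) :
    ‖p z - 1‖ ^ 2 ≤ (M / α₁) ^ 2 * (Real.pi ^ 2 / 6) := by
  let a : ℕ → ℂ := fun n => iteratedDeriv n p 0 / n.factorial
  let l : ℕ → ℝ := fun n => α₁ * n + α₂ * n.descFactorial 2 + α₃ * n.descFactorial 3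
  have hl : ∀ n, α₁ * n ≤ l n := fun n => by
    have h1 : 0 ≤ α₂ * (n.descFactorial 2 : ℝ) := by positivity
    have h2 : 0 ≤ α₃ * (n.descFactorial 3 : ℝ) := by positivity
    simp only [l]; linarith
  have hl0 : ∀ n, 0 ≤ l n := fun n => (by positivity : 0 ≤ α₁ * (n : ℝ)).trans (hl n)
  have hP : ∀ z ∈ Metric.ball (0 : ℂ) 1,
      HasSum (fun n => (l n * a n) * z ^ n) (thirdOrderExpr α₁ α₂ α₃ p z - 1) := by
    intro z hz
    have h := (((hasSum_pow_mul_iteratedDeriv hp 1 hz).mul_left (α₁ : ℂ)).add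
      ((hasSum_pow_mul_iteratedDeriv hp 2 hz).mul_left (α₂ : ℂ))).add
      ((hasSum_pow_mul_iteratedDeriv hp 3 hz).mul_left (α₃ : ℂ))
    convert! h using 1
    · funext n; simp only [l, a, Nat.descFactorial_one]; push_cast; ring
    · simp only [thirdOrderExpr, iteratedDeriv_one]; ring
  set r := ‖z‖ with hr
  have hr1 : r < 1 := by simpa using hz
  have hball : ∀ w : ℂ, ‖w‖ = r → w ∈ Metric.ball (0 : ℂ) 1 := fun w hw => by simp [hw, hr1]
  have hB := sum_sq_coeff_le_of_norm_le (norm_nonneg z)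
    (by
      have := (hP z hz).summable.norm
      simpa only [norm_mul, norm_pow] using this)
    (fun w hw => hP w (hball w hw)) (fun w hw => hM w (hball w hw))
  have hp1 : HasSum (fun n => a (n + 1) * z ^ (n + 1)) (p z - 1) := by
    have h := hasSum_pow_mul_iteratedDeriv hp 0 hz
    rw [← hasSum_nat_add_iff' 1] at h
    simpa [a, hp0] using h
  have hM0 : 0 ≤ M := (norm_nonneg _).trans (hM z hz)
  have hpart : ∀ s : Finset ℕ,
      ‖∑ n ∈ s, a (n + 1) * z ^ (n + 1)‖ ^ 2 ≤ (M / α₁) ^ 2 * (Real.pi ^ 2 / 6) := by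
    intro s
    -- The shift keeps `0` out of `t`, so the weights `1 / n` really cancel the factors `n`.
    let t := s.map (addRightEmbedding 1)
    have h1 : ‖∑ n ∈ s, a (n + 1) * z ^ (n + 1)‖
        ≤ ∑ n ∈ t, (1 / (n : ℝ)) * (n * (‖a n‖ * r ^ n)) := by
      refine (norm_sum_le _ _).trans (le_of_eq ?_)
      simp only [t, Finset.sum_map, addRightEmbedding_apply]
      refine Finset.sum_congr rfl fun n _ => ?_
      have : ((n + 1 : ℕ) : ℝ) ≠ 0 := by positivity
      rw [norm_mul, norm_pow, ← mul_assoc, one_div_mul_cancel this, one_mul]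
    have h2 : ∑ n ∈ t, (n * (‖a n‖ * r ^ n)) ^ 2 ≤ (M / α₁) ^ 2 := by
      rw [div_pow, le_div_iff₀ (by positivity), Finset.sum_mul]
      refine (Finset.sum_le_sum fun n _ => ?_).trans (hB t)
      rw [← mul_pow]
      have hn : ‖(l n : ℂ) * a n‖ = l n * ‖a n‖ := by simp [abs_of_nonneg (hl0 n)]
      rw [hn]
      have : (n : ℝ) * (‖a n‖ * r ^ n) * α₁ = α₁ * n * ‖a n‖ * r ^ n := by ring
      rw [this]
      have hr0 : 0 ≤ r := norm_nonneg z
      have := hl n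
      gcongr
    have h3 : ∑ n ∈ t, (1 / (n : ℝ)) ^ 2 ≤ Real.pi ^ 2 / 6 := by
      simp only [one_div_pow]
      exact sum_le_hasSum _ (fun n _ => by positivity) hasSum_zeta_two
    calc ‖∑ n ∈ s, a (n + 1) * z ^ (n + 1)‖ ^ 2
        ≤ (∑ n ∈ t, (1 / (n : ℝ)) * (n * (‖a n‖ * r ^ n))) ^ 2 := by gcongr
      _ ≤ (∑ n ∈ t, (1 / (n : ℝ)) ^ 2) * ∑ n ∈ t, (n * (‖a n‖ * r ^ n)) ^ 2 :=
        Finset.sum_mul_sq_le_sq_mul_sq _ _ _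
      _ ≤ (Real.pi ^ 2 / 6) * (M / α₁) ^ 2 := by gcongr
      _ = _ := mul_comm _ _
  exact le_of_tendsto (hp1.norm.pow 2) (Filter.Eventually.of_forall hpart)

/-- With `x = 29 / 50`, `|log p| ≤ x + x ^ 2 / (2 (1 - x)) < 0.99`, so `log p` maps the disk into
itself and fixes `0`. The radius also exceeds `π / √30`, the bound available for `|p - 1|`. -/
theorem isSubordinate_exp_of_norm_sub_one_le {p : ℂ → ℂ}
    (hp : DifferentiableOn ℂ p (Metric.ball 0 1)) (hp0 : p 0 = 1)
    (h : ∀ z ∈ Metric.ball (0 : ℂ) 1, ‖p z - 1‖ ≤ 29 / 50) : IsSubordinate p Complex.exp := by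
  have hslit : ∀ z ∈ Metric.ball (0 : ℂ) 1, p z ∈ Complex.slitPlane := fun z hz => by
    have := Complex.mem_slitPlane_of_norm_lt_one (z := p z - 1) ((h z hz).trans_lt (by norm_num))
    simpa using this
  have hd : DifferentiableOn ℂ (fun z => Complex.log (p z)) (Metric.ball 0 1) := hp.clog hslit
  refine ⟨fun z => Complex.log (p z), ⟨hd, by simp [hp0], fun z hz => ?_⟩, fun z hz =>
    (Complex.exp_log (Complex.slitPlane_ne_zero (hslit z hz))).symm⟩
  refine Complex.norm_le_norm_of_mapsTo_ball hd (fun w hw => ?_) (by simp [hp0])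
    (by simpa using hz)
  have hw1 := h w hw
  have h1 := Complex.norm_log_one_add_le (hw1.trans_lt (by norm_num : (29 / 50 : ℝ) < 1))
  rw [add_sub_cancel] at h1
  have h2 : (1 - ‖p w - 1‖)⁻¹ ≤ 50 / 21 := by
    rw [inv_le_comm₀ (by linarith) (by norm_num)]; linarith
  have h0 : 0 ≤ (1 - ‖p w - 1‖)⁻¹ := inv_nonneg.mpr (by linarith)
  have h3 : ‖p w - 1‖ ^ 2 * (1 - ‖p w - 1‖)⁻¹ ≤ (29 / 50) ^ 2 * (50 / 21) := by gcongr
  rw [mem_closedBall_zero_iff]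
  linarith

/-- The criterion behind all cases: it suffices that `h - 1` is bounded by `c / √5`. -/
theorem isSubordinate_exp_of_thirdOrderExpr {α₁ α₂ α₃ M c : ℝ} {p h : ℂ → ℂ} (hα₂ : 0 ≤ α₂)
    (hα₃ : 0 ≤ α₃) (hc : 0 < c) (hcα : c ≤ α₁) (hp : DifferentiableOn ℂ p (Metric.ball 0 1))
    (hp0 : p 0 = 1) (hh : ∀ z ∈ Metric.ball (0 : ℂ) 1, ‖h z - 1‖ ≤ M) (hMc : 5 * M ^ 2 ≤ c ^ 2)
    (hs : IsSubordinate (thirdOrderExpr α₁ α₂ α₃ p) h) : IsSubordinate p Complex.exp := by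
  obtain ⟨w, ⟨-, -, hw⟩, hPw⟩ := hs
  refine isSubordinate_exp_of_norm_sub_one_le hp hp0 fun z hz => ?_
  have h1 := sq_norm_sub_one_le (M := M) (hc.trans_le hcα) hα₂ hα₃ hp hp0
    (fun z hz => by
      rw [hPw z hz]
      exact hh _ (by simpa using (hw z hz).trans_lt (by simpa using hz))) hz
  have h2 : (M / α₁) ^ 2 ≤ 1 / 5 := by
    rw [div_pow, div_le_iff₀ (pow_pos (hc.trans_le hcα) 2)]
    have : c ^ 2 ≤ α₁ ^ 2 := by gcongr
    linarith
  have h3 : Real.pi ^ 2 ≤ 3.15 ^ 2 := by gcongr; exact Real.pi_lt_d2.le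
  refine le_of_sq_le_sq (h1.trans ?_) (by norm_num)
  calc (M / α₁) ^ 2 * (Real.pi ^ 2 / 6) ≤ 1 / 5 * (3.15 ^ 2 / 6) := by gcongr
    _ ≤ _ := by norm_num

/-! ### Bounds for the five target functions on the unit disk -/

theorem norm_exp_sub_one_le_of_mem_ball {z : ℂ} (hz : z ∈ Metric.ball (0 : ℂ) 1) :
    ‖Complex.exp z - 1‖ ≤ Real.exp 1 - 1 := by
  have h := Complex.norm_exp_sub_sum_le_exp_norm_sub_sum z 1
  have h1 : ‖z‖ < 1 := by simpa using hz
  have h2 := Real.exp_le_exp.mpr h1.le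
  simp only [Finset.range_one, Finset.sum_singleton, pow_zero, Nat.factorial_zero, Nat.cast_one,
    div_one] at h
  linarith

theorem norm_mul_exp_le_of_mem_ball {z : ℂ} (hz : z ∈ Metric.ball (0 : ℂ) 1) :
    ‖z * Complex.exp z‖ ≤ Real.exp 1 := by
  have h1 : ‖z‖ < 1 := by simpa using hz
  rw [norm_mul]
  calc ‖z‖ * ‖Complex.exp z‖ ≤ 1 * Real.exp 1 := by
        gcongr
        exact (Complex.norm_exp_le_exp_norm z).trans (Real.exp_le_exp.mpr h1.le)
    _ = _ := one_mul _

theorem Complex.norm_sin_le_sinh_norm (z : ℂ) : ‖Complex.sin z‖ ≤ Real.sinh ‖z‖ := by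
  rw [← (Complex.hasSum_sin z).tsum_eq]
  exact tsum_of_norm_bounded (Real.hasSum_sinh ‖z‖) fun n => by simp

theorem norm_sin_le_of_mem_ball {z : ℂ} (hz : z ∈ Metric.ball (0 : ℂ) 1) :
    ‖Complex.sin z‖ ≤ Real.sinh 1 := by
  have h1 : ‖z‖ < 1 := by simpa using hz
  exact (Complex.norm_sin_le_sinh_norm z).trans (Real.sinh_le_sinh.mpr h1.le)

theorem Complex.sqrt_sq (z : ℂ) : Complex.sqrt z ^ 2 = z := by
  simp only [Complex.sqrt]
  exact Complex.cpow_nat_inv_pow z two_ne_zero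

theorem Complex.re_sqrt_nonneg (z : ℂ) : 0 ≤ (Complex.sqrt z).re := by
  rw [Complex.sqrt, Complex.cpow_inv_two_re]
  exact Real.sqrt_nonneg _

theorem mul_sqrt_one_add_sq_sub (z : ℂ) :
    (z + Complex.sqrt (1 + z ^ 2)) * (Complex.sqrt (1 + z ^ 2) - z) = 1 := by
  linear_combination Complex.sqrt_sq (1 + z ^ 2)

/-- For `u = z + √(1 + z ^ 2)`, `u + u⁻¹` is twice a principal root, and `u`, `u⁻¹` have real parts
of the same sign. -/
theorem re_add_sqrt_one_add_sq_nonneg (z : ℂ) : 0 ≤ (z + Complex.sqrt (1 + z ^ 2)).re := by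
  set u := z + Complex.sqrt (1 + z ^ 2) with hu
  have h1 : u * (Complex.sqrt (1 + z ^ 2) - z) = 1 := mul_sqrt_one_add_sq_sub z
  have h2 : Complex.sqrt (1 + z ^ 2) - z = u⁻¹ := eq_inv_of_mul_eq_one_right h1
  have h3 : u.re + u⁻¹.re = 2 * (Complex.sqrt (1 + z ^ 2)).re := by
    rw [← h2, hu]; simp; ring
  rw [Complex.inv_re] at h3
  have h4 := Complex.re_sqrt_nonneg (1 + z ^ 2)
  have h5 : 0 ≤ u.re * (1 + 1 / Complex.normSq u) := by
    have : u.re * (1 + 1 / Complex.normSq u) = u.re + u.re / Complex.normSq u := by ring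
    rw [this]; linarith
  exact nonneg_of_mul_nonneg_left h5
    (add_pos_of_pos_of_nonneg one_pos (one_div_nonneg.mpr (Complex.normSq_nonneg u)))

/-- The crescent lies in the disk of radius `√2` about `1`. -/
theorem norm_add_sqrt_one_add_sq_sub_one_le {z : ℂ} (hz : z ∈ Metric.ball (0 : ℂ) 1) :
    ‖z + Complex.sqrt (1 + z ^ 2) - 1‖ ≤ Real.sqrt 2 := by
  have hz1 : ‖z‖ < 1 := by simpa using hz
  have hre := re_add_sqrt_one_add_sq_nonneg z
  have h1 : (z + Complex.sqrt (1 + z ^ 2)) ^ 2 - 1 = 2 * (z + Complex.sqrt (1 + z ^ 2)) * z := by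
    linear_combination Complex.sqrt_sq (1 + z ^ 2)
  set u := z + Complex.sqrt (1 + z ^ 2)
  have h2 : Complex.normSq (u ^ 2 - 1) ≤ 4 * Complex.normSq u := by
    rw [h1, map_mul, map_mul]
    have : Complex.normSq z ≤ 1 := by
      rw [Complex.normSq_eq_norm_sq]; nlinarith [norm_nonneg z]
    have h4 : Complex.normSq 2 = 4 := by norm_num [Complex.normSq_apply]
    rw [h4]
    nlinarith [Complex.normSq_nonneg u]
  apply Real.le_sqrt_of_sq_le
  rw [← Complex.normSq_eq_norm_sq]
  simp only [Complex.normSq_apply, Complex.sub_re, Complex.sub_im, Complex.one_re, Complex.one_im,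
    pow_two, Complex.mul_re, Complex.mul_im] at h2 ⊢
  -- Let `A = |u - 1| ^ 2` and `B = |u + 1| ^ 2`. If `A > 2`, then `B ≥ A > 2`, so `(A - 2) (B - 2)
  -- > 0`; as `A + B = 2 |u| ^ 2 + 2`, this gives `A B > 4 |u| ^ 2`, contradicting `h2`.
  by_contra! hlt
  have hA : 2 < (u.re + 1) * (u.re + 1) + u.im * u.im := by nlinarith
  nlinarith [mul_pos (sub_pos.mpr hlt) (sub_pos.mpr hA)]

/-- The logarithm lies in the rectangle `|Re| ≤ 1`, `|Im| ≤ π / 2`: `u` and `u⁻¹ = √(1 + z ^ 2) - z`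
have modulus at most `5 / 2 < e`, and `Re u ≥ 0`. -/
theorem sq_norm_complexArsinh_le {z : ℂ} (hz : z ∈ Metric.ball (0 : ℂ) 1) :
    ‖complexArsinh z‖ ^ 2 ≤ 1 + (Real.pi / 2) ^ 2 := by
  have hz1 : ‖z‖ < 1 := by simpa using hz
  have hre := re_add_sqrt_one_add_sq_nonneg z
  have hs : ‖Complex.sqrt (1 + z ^ 2)‖ ≤ 3 / 2 := by
    have h1 : ‖Complex.sqrt (1 + z ^ 2)‖ ^ 2 ≤ 1 + ‖z‖ ^ 2 := by
      rw [← norm_pow, Complex.sqrt_sq]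
      exact (norm_add_le _ _).trans_eq (by rw [norm_one, norm_pow])
    refine le_of_sq_le_sq (h1.trans ?_) (by norm_num)
    nlinarith [norm_nonneg z]
  have he : (5 / 2 : ℝ) ≤ Real.exp 1 := by linarith [Real.exp_one_gt_d9]
  have hmul := mul_sqrt_one_add_sq_sub z
  have hv : ‖Complex.sqrt (1 + z ^ 2) - z‖ ≤ Real.exp 1 :=
    (norm_sub_le _ _).trans (by linarith)
  have hu : ‖z + Complex.sqrt (1 + z ^ 2)‖ ≤ Real.exp 1 :=
    (norm_add_le _ _).trans (by linarith)
  rw [complexArsinh]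
  set u := z + Complex.sqrt (1 + z ^ 2)
  have hu0 : 0 < ‖u‖ := norm_pos_iff.mpr (left_ne_zero_of_mul_eq_one hmul)
  have h1 : Real.log ‖u‖ ≤ 1 := by
    rw [Real.log_le_iff_le_exp hu0]; exact hu
  have h2 : -1 ≤ Real.log ‖u‖ := by
    rw [Real.le_log_iff_exp_le hu0, Real.exp_neg, inv_le_iff_one_le_mul₀ (Real.exp_pos 1)]
    calc (1 : ℝ) = ‖u‖ * ‖Complex.sqrt (1 + z ^ 2) - z‖ := by rw [← norm_mul, hmul, norm_one]
      _ ≤ _ := by gcongr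
  have h3 : |u.arg| ≤ Real.pi / 2 := Complex.abs_arg_le_pi_div_two_iff.mpr hre
  rw [← Complex.normSq_eq_norm_sq, Complex.normSq_apply, Complex.log_re, Complex.log_im]
  have h4 : u.arg ^ 2 ≤ (Real.pi / 2) ^ 2 := sq_le_sq' (abs_le.mp h3).1 (abs_le.mp h3).2
  nlinarith

theorem five_le_sq_exp_one : 5 ≤ Real.exp 1 ^ 2 := by nlinarith [Real.exp_one_gt_d9]

theorem mainTheorem12 (α₁ α₂ α₃ m k : ℝ) (hα₁ : 0 < α₁) (hα₂ : 0 < α₂) (hα₃ : 0 < α₃)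
    (hm : 2 ≤ m) (hk : m ≤ k) (p : ℂ → ℂ)
    (hp : DifferentiableOn ℂ p (Metric.ball 0 1)) (hp0 : p 0 = 1) :
    -- the exponential domain
    (α₁ - α₂ - m ^ 2 * α₃ - 3 * m * (k - 1) * α₃ ≥ Real.exp 1 * (Real.exp 1 - 1) →
      IsSubordinate (thirdOrderExpr α₁ α₂ α₃ p) Complex.exp → IsSubordinate p Complex.exp) ∧
    -- the crescent
    (α₁ - α₂ - m ^ 2 * α₃ - 3 * m * (k - 1) * α₃ ≥ Real.sqrt 2 * Real.exp 1 →
      IsSubordinate (thirdOrderExpr α₁ α₂ α₃ p) (fun z => z + Complex.sqrt (1 + z ^ 2)) →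
      IsSubordinate p Complex.exp) ∧
    -- the sine domain
    (α₁ - α₂ - m ^ 2 * α₃ - 3 * m * (k - 1) * α₃ ≥ Real.exp 1 * Real.sinh 1 →
      IsSubordinate (thirdOrderExpr α₁ α₂ α₃ p) (fun z => 1 + Complex.sin z) →
      IsSubordinate p Complex.exp) ∧
    -- the cardioid
    (α₁ - α₂ - m ^ 2 * α₃ - 3 * m * (k - 1) * α₃ ≥ Real.exp 1 ^ 2 →
      IsSubordinate (thirdOrderExpr α₁ α₂ α₃ p) (fun z => 1 + z * Complex.exp z) →
      IsSubordinate p Complex.exp) ∧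
    -- the domain of `1 + sinh⁻¹ z`
    (2 * (α₁ - α₂ - m ^ 2 * α₃ - 3 * m * (k - 1) * α₃) ≥ Real.pi * Real.exp 1 →
      IsSubordinate (thirdOrderExpr α₁ α₂ α₃ p) (fun z => 1 + complexArsinh z) →
      IsSubordinate p Complex.exp) := by 
  have hL : α₁ - α₂ - m ^ 2 * α₃ - 3 * m * (k - 1) * α₃ ≤ α₁ := by
    have h1 : 0 ≤ m ^ 2 * α₃ := by positivity
    have h2 : 0 ≤ 3 * m * (k - 1) * α₃ :=
      mul_nonneg (mul_nonneg (by linarith) (by linarith)) hα₃.le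
    linarith
  have he := Real.exp_one_gt_d9
  have he2 := five_le_sq_exp_one
  have hsinh : 0 < Real.sinh 1 := Real.sinh_pos_iff.mpr one_pos
  have key : ∀ {M c : ℝ} {h : ℂ → ℂ},
      α₁ - α₂ - m ^ 2 * α₃ - 3 * m * (k - 1) * α₃ ≥ c → 0 < c →
      (∀ z ∈ Metric.ball (0 : ℂ) 1, ‖h z - 1‖ ≤ M) → 5 * M ^ 2 ≤ c ^ 2 →
      IsSubordinate (thirdOrderExpr α₁ α₂ α₃ p) h → IsSubordinate p Complex.exp :=
    fun hc hc0 hh hMc hs =>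
      isSubordinate_exp_of_thirdOrderExpr hα₂.le hα₃.le hc0 (hc.trans hL) hp hp0 hh hMc hs
  refine ⟨fun h => key h ?_ (fun z hz => norm_exp_sub_one_le_of_mem_ball hz) ?_,
    fun h => key h (by positivity) (fun z hz => norm_add_sqrt_one_add_sq_sub_one_le hz) ?_,
    fun h => key h (by positivity)
      (fun z hz => by simpa using norm_sin_le_of_mem_ball hz) ?_,
    fun h => key h (by positivity)
      (fun z hz => by simpa using norm_mul_exp_le_of_mem_ball hz) ?_,
    fun h => key (c := Real.pi * Real.exp 1 / 2) (M := Real.sqrt (1 + (Real.pi / 2) ^ 2))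
      (by linarith) (by positivity)
      (fun z hz => Real.le_sqrt_of_sq_le (by simpa using sq_norm_complexArsinh_le hz)) ?_⟩
  · exact mul_pos (Real.exp_pos 1) (by linarith)
  · rw [mul_pow]; gcongr
  · rw [mul_pow, mul_comm]; gcongr
  · rw [mul_pow]; gcongr
  · rw [pow_two (Real.exp 1 ^ 2)]; gcongr
  · rw [Real.sq_sqrt (by positivity)]
    have hpi : 3.14 ^ 2 ≤ Real.pi ^ 2 := by gcongr; exact Real.pi_gt_d2.le
    -- Here `M` exceeds `π / 2`, so `e ^ 2 ≥ 5` no longer suffices.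
    have he3 : (7.38 : ℝ) ≤ Real.exp 1 ^ 2 := by nlinarith
    have : Real.pi ^ 2 * 7.38 ≤ Real.pi ^ 2 * Real.exp 1 ^ 2 := by gcongr
    have h2 : (Real.pi * Real.exp 1 / 2) ^ 2 = Real.pi ^ 2 * Real.exp 1 ^ 2 / 4 := by ring
    rw [h2]
    nlinarith
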